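/- Let $\theta\in(0,\pi/2)$ and let $S_\theta=\{z\in\mathbb C\setminus\{0\}: |\arg z|<\pi-\theta\}$, where $\arg$ is the principal argument. For $\lambda\in S_\theta$ write $\lambda=re^{i\tau}$ with $r>0$ and $|\tau|<\pi-\theta$, and put $k=\sqrt r\,e^{i(\pi+\tau)/2}$, so that $k^2=-\lambda$ and $\operatorname{Im}k>0$. For $x\in\mathbb R^2\setminus\{0\}$ let $$G(x;\lambda)=\tfrac{i}{4}H^{(1)}_0(k|x|),\qquad G(x;0)=-\tfrac1{2\pi}\log|x|,$$ where $H^{(1)}_0=J_0+iY_0$ is the Hankel function of the first kind of order zero. For $\alpha,\beta\in\{1,2\}$ let $$\Gamma_{\alpha\beta}(x;\lambda)=G(x;\lambda)\,\delta_{\alpha\beta}-\frac1\lambda\,\partial_{x_\alpha}\partial_{x_\beta}\{G(x;\lambda)-G(x;0)\},\qquad \Gamma_{\alpha\beta}(x;0)=\frac1{4\pi}\Big\{-\delta_{\alpha\beta}\log|x|+\frac{x_\alpha x_\beta}{|x|^2}\Big\}$$ be the matrices of fundamental solutions (velocity part) of the Stokes resolvent problem and of the stationary Stokes problem in $\mathbb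 R^2$, and for a matrix field $F$ let $|\nabla F|=\big(\sum_{\alpha,\beta,\gamma=1}^2|\partial_{x_\gamma}F_{\alpha\beta}|^2\big)^{1/2}$. Then there is a constant $C>0$ depending only on $\theta$ such that for all $\lambda\in S_\theta$ and all $x\in\mathbb R^2\setminus\{0\}$ with $|\lambda||x|^2\le\frac12$ the derivatives involved exist in the classical sense ($G(\cdot;\lambda)-G(\cdot;0)$ is three times continuously differentiable near $x$ and $\Gamma(\cdot;\lambda)-\Gamma(\cdot;0)$ is differentiable at $x$) and $$\big|\nabla_x\{\Gamma(x;\lambda)-\Gamma(x;0)\}\big|\le C\,|\lambda|\,|x|\,\big|\log(|\lambda||x|^2)\big|.$$ -/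

import Mathlib

noncomputable section

namespace StokesResolvent

/-- The plane `ℝ²` with its Euclidean norm. -/
abbrev Plane : Type := EuclideanSpace ℝ (Fin 2)

/-- The sector `S_θ = {z ∈ ℂ \ {0} : |arg z| < π - θ}`, with the principal argument. -/
def sector (θ : ℝ) : Set ℂ := {z : ℂ | z ≠ 0 ∧ |Complex.arg z| < Real.pi - θ}

/-- The partial derivative `∂_γ f (x)`. -/
def partialDeriv (γ : Fin 2) (f : Plane → ℂ) (x : Plane) : ℂ :=
  lineDeriv ℝ f x (EuclideanSpace.single γ 1)

/-- The Bessel function of the first kind of order zero,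
`J₀(z) = ∑ (-1)^ℓ / (ℓ!)² (z/2)^(2ℓ)`. -/
def besselJ0 (z : ℂ) : ℂ :=
  ∑' l : ℕ, (-1 : ℂ) ^ l / ((Nat.factorial l : ℂ) ^ 2) * (z / 2) ^ (2 * l)

/-- The Bessel function of the second kind of order zero (principal branch),
`Y₀(z) = (2/π) log(z/2) J₀(z) - (2/π) ∑ (-1)^ℓ / (ℓ!)² ψ(ℓ+1) (z/2)^(2ℓ)`,
where `ψ = Γ'/Γ` is the digamma function. -/
def besselY0 (z : ℂ) : ℂ :=
  2 / (Real.pi : ℂ) * Complex.log (z / 2) * besselJ0 z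
    - 2 / (Real.pi : ℂ) *
      ∑' l : ℕ, (-1 : ℂ) ^ l / ((Nat.factorial l : ℂ) ^ 2)
        * Complex.digamma ((l : ℂ) + 1) * (z / 2) ^ (2 * l)

/-- The Hankel function of the first kind of order zero, `H₀⁽¹⁾ = J₀ + i Y₀`. -/
def hankelH0 (z : ℂ) : ℂ := besselJ0 z + Complex.I * besselY0 z

/-- `k = √r e^{i(π + τ)/2}` for `λ = r e^{iτ}`, so that `k² = -λ` and `Im k > 0` for `λ`
off the closed negative real axis. -/
def waveNumber (lam : ℂ) : ℂ :=
  (Real.sqrt ‖lam‖ : ℂ) * Complex.exp (Complex.I * ((Real.pi + Complex.arg lam : ℝ) : ℂ) / 2)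

/-- `G(x; λ) = (i/4) H₀⁽¹⁾(k|x|)`, the fundamental solution of `λ u - Δ u = 0`, for `λ ≠ 0`. -/
def helmholtzG (lam : ℂ) (x : Plane) : ℂ :=
  Complex.I / 4 * hankelH0 (waveNumber lam * (‖x‖ : ℂ))

/-- `G(x; 0) = -(1/2π) log |x|`, the fundamental solution of the Laplace equation. -/
def laplaceG (x : Plane) : ℂ := ((-(1 / (2 * Real.pi)) * Real.log ‖x‖ : ℝ) : ℂ)

/-- The velocity matrix of fundamental solutions of the Stokes resolvent problem, `λ ≠ 0`:
`Γ_{αβ}(x; λ) = G(x; λ) δ_{αβ} - (1/λ) ∂_α ∂_β {G(x; λ) - G(x; 0)}`. -/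
def resolventGamma (lam : ℂ) (x : Plane) : Matrix (Fin 2) (Fin 2) ℂ :=
  Matrix.of fun α β =>
    helmholtzG lam x * (if α = β then 1 else 0)
      - 1 / lam *
        partialDeriv α (partialDeriv β (fun y => helmholtzG lam y - laplaceG y)) x

/-- The velocity matrix of fundamental solutions of the stationary Stokes problem:
`Γ_{αβ}(x; 0) = (1/4π) {-δ_{αβ} log |x| + x_α x_β / |x|²}`. -/
def stationaryGamma (x : Plane) : Matrix (Fin 2) (Fin 2) ℂ :=
  Matrix.of fun α β =>
    ((1 / (4 * Real.pi) *
      (-((if α = β then 1 else 0) * Real.log ‖x‖) + x α * x β / ‖x‖ ^ 2) : ℝ) : ℂ)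

/-- The Euclidean length `|∇F(x)|` of the array `(∂_γ F_{αβ}(x))_{α,β,γ}` of all first-order
partial derivatives of a matrix field. -/
def gradNorm (F : Plane → Matrix (Fin 2) (Fin 2) ℂ) (x : Plane) : ℝ :=
  Real.sqrt (∑ γ : Fin 2, ∑ α : Fin 2, ∑ β : Fin 2,
    ‖partialDeriv γ (fun y => F y α β) x‖ ^ 2)

end StokesResolvent

end

noncomputable section

namespace StokesResolvent

open Complex Filter Topology

/-! Everything is a function of the single variable `w = λ|x|²/4`. Since `(k|x|/2)² = -w`, the
Bessel series give `-4π G(x; λ) = log w · A(w) - 2 B(w)` with `A`, `B` entire. Subtracting the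
Laplace solution removes the leading `log w` up to the constant `log (λ/4)`.

Two further cancellations occur in `Γ(·; λ) - Γ(·; 0)` (`resolventGamma_sub_stationaryGamma`). The
`1/w` in the second derivative of the profile reproduces the stationary term `x_α x_β / |x|²`, and
the bare logarithms multiplying `δ_{αβ}` combine to a constant. What remains is `δ_{αβ} P(w)` and `λ
x_α x_β R(w)`, where `P` and `R` have the form `log w · entire + entire` and in `P` the factor of
`log w` vanishes at `0`.

Hence `P'`, `R` and `w R'` are all `O(|log w| + 1)` for `|w| ≤ 1`. The chain rule supplies `λ x_γ /
2`, so each entry of the gradient is `O(|λ||x|(|log w| + 1))`, and the smallness of `|λ||x|²` turns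
`|log w| + 1` into a multiple of `|log (|λ||x|²)|`. -/

/-- A power series whose coefficients are `O(1 / l!)` defines an entire function. -/
theorem differentiable_tsum_mul_pow {c : ℕ → ℂ} {K : ℝ}
    (hc : ∀ l, ‖c l‖ ≤ K / (l.factorial : ℝ)) :
    Differentiable ℂ fun w : ℂ => ∑' l, c l * w ^ l := by
  intro w
  have hle : ∀ (l : ℕ) (v : ℂ), v ∈ Metric.ball (0 : ℂ) (‖w‖ + 1) →
      ‖c l * v ^ l‖ ≤ K * ((‖w‖ + 1) ^ l / (l.factorial : ℝ)) := by
    intro l v hv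
    have hv' : ‖v‖ ≤ ‖w‖ + 1 := by simpa using (mem_ball_zero_iff.1 hv).le
    calc ‖c l * v ^ l‖ = ‖c l‖ * ‖v‖ ^ l := by rw [norm_mul, norm_pow]
      _ ≤ K / (l.factorial : ℝ) * (‖w‖ + 1) ^ l := by
          refine mul_le_mul (hc l) (by gcongr) (by positivity) ((norm_nonneg _).trans (hc l))
      _ = _ := by ring
  have h : DifferentiableOn ℂ (fun w : ℂ => ∑' l, c l * w ^ l) (Metric.ball 0 (‖w‖ + 1)) :=
    differentiableOn_tsum_of_summable_norm (u := fun l => K * ((‖w‖ + 1) ^ l / (l.factorial : ℝ)))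
      ((Real.summable_pow_div_factorial _).mul_left K)
      (fun l => ((differentiable_id.pow l).const_mul (c l)).differentiableOn)
      Metric.isOpen_ball hle
  exact h.differentiableAt (Metric.isOpen_ball.mem_nhds (by simp))

theorem summable_mul_pow {c : ℕ → ℂ} {K : ℝ}
    (hc : ∀ l, ‖c l‖ ≤ K / (l.factorial : ℝ)) (w : ℂ) : Summable fun l => c l * w ^ l := by
  refine Summable.of_norm_bounded
    ((Real.summable_pow_div_factorial ‖w‖).mul_left K) fun l => ?_
  calc ‖c l * w ^ l‖ = ‖c l‖ * ‖w‖ ^ l := by rw [norm_mul, norm_pow]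
    _ ≤ K / (l.factorial : ℝ) * ‖w‖ ^ l := by gcongr; exact hc l
    _ = _ := by ring

/-! ### Entire series behind the Bessel functions -/

/-- The entire function `A(w) = ∑ w ^ l / (l!)²`, for which `J₀(z) = A(-(z/2)²)`. -/
def seriesA (w : ℂ) : ℂ := ∑' l : ℕ, 1 / ((l.factorial : ℂ) ^ 2) * w ^ l

/-- The remainder in `A(w) = 1 + w + w² E(w)`. -/
def seriesE (w : ℂ) : ℂ := ∑' l : ℕ, 1 / (((l + 2).factorial : ℂ) ^ 2) * w ^ l

/-- The entire function `B(w) = ∑ ψ(l + 1) w ^ l / (l!)²`. -/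
def seriesB (w : ℂ) : ℂ :=
  ∑' l : ℕ, 1 / ((l.factorial : ℂ) ^ 2) * digamma ((l : ℂ) + 1) * w ^ l

theorem norm_one_div_factorial_sq_le (l : ℕ) :
    ‖1 / ((l.factorial : ℂ) ^ 2)‖ ≤ 1 / (l.factorial : ℝ) := by
  have h : (1 : ℝ) ≤ l.factorial := by exact_mod_cast l.factorial_pos
  rw [norm_div, norm_one, norm_pow, Complex.norm_natCast]
  exact one_div_le_one_div_of_le (by positivity) (by nlinarith)

/-- Induction on `ψ(z + 1) = ψ(z) + 1/z`, starting from `ψ(1) = -γ`. Linear growth is crude but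
enough: one of the two factorials in the coefficients of `B` absorbs it. -/
theorem norm_digamma_natCast_add_one_le (l : ℕ) : ‖digamma ((l : ℂ) + 1)‖ ≤ (l : ℝ) + 1 := by
  induction l with
  | zero =>
    have h1 := Real.eulerMascheroniConstant_lt_two_thirds
    have h2 := Real.one_half_lt_eulerMascheroniConstant
    simp only [Nat.cast_zero, zero_add, digamma_one, norm_neg, norm_real, Real.norm_eq_abs]
    rw [abs_le]
    constructor <;> linarith
  | succ l ih =>
    have h : ∀ m : ℕ, ((l : ℂ) + 1) ≠ -m := by
      intro m hm
      have : ((l + 1 + m : ℕ) : ℂ) = 0 := by push_cast; rw [hm]; ring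
      exact absurd (Nat.cast_eq_zero.1 this) (by omega)
    have h' : ‖((l : ℂ) + 1)⁻¹‖ ≤ 1 := by
      rw [norm_inv]
      refine inv_le_one_of_one_le₀ ?_
      have : ((l : ℂ) + 1) = ((l + 1 : ℕ) : ℂ) := by push_cast; rfl
      rw [this, Complex.norm_natCast]
      push_cast
      linarith [(l.cast_nonneg : (0 : ℝ) ≤ l)]
    push_cast
    rw [digamma_apply_add_one _ h]
    exact (norm_add_le _ _).trans (add_le_add ih h')

theorem differentiable_seriesE : Differentiable ℂ seriesE := by
  refine differentiable_tsum_mul_pow (K := 1) fun l =>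
    (norm_one_div_factorial_sq_le (l + 2)).trans ?_
  have : (l.factorial : ℝ) ≤ ((l + 2).factorial : ℝ) := by
    exact_mod_cast Nat.factorial_le (by omega)
  exact one_div_le_one_div_of_le (by exact_mod_cast l.factorial_pos) this

theorem differentiable_seriesB : Differentiable ℂ seriesB := by
  refine differentiable_tsum_mul_pow (K := 2) fun l => ?_
  have h0 : (0 : ℝ) < l.factorial := by exact_mod_cast l.factorial_pos
  have h2 : (l : ℝ) + 1 ≤ 2 * l.factorial := by
    have h3 := Nat.self_le_factorial l
    have h4 := l.factorial_pos
    exact_mod_cast (by omega : l + 1 ≤ 2 * l.factorial)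
  rw [norm_mul, norm_div, norm_one, norm_pow, Complex.norm_natCast]
  calc 1 / (l.factorial : ℝ) ^ 2 * ‖digamma ((l : ℂ) + 1)‖
      ≤ 1 / (l.factorial : ℝ) ^ 2 * (2 * l.factorial) := by
        gcongr
        exact (norm_digamma_natCast_add_one_le l).trans h2
    _ = 2 / (l.factorial : ℝ) := by field_simp

theorem seriesA_eq (w : ℂ) : seriesA w = 1 + w + w ^ 2 * seriesE w := by
  have h := (summable_mul_pow norm_one_div_factorial_sq_le w).sum_add_tsum_nat_add 2
  rw [seriesA, ← h, seriesE, ← tsum_mul_left]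
  congr 1
  · simp [Finset.sum_range_succ]
  · exact tsum_congr fun l => by ring

theorem besselJ0_eq_seriesA {z w : ℂ} (h : (z / 2) ^ 2 = -w) : besselJ0 z = seriesA w := by
  refine tsum_congr fun l => ?_
  rw [pow_mul, h, neg_pow w]
  have : ((-1 : ℂ) ^ l) * (-1) ^ l = 1 := by rw [← mul_pow]; simp
  linear_combination (1 / ((l.factorial : ℂ) ^ 2) * w ^ l) * this

theorem besselY0_eq_series {z w : ℂ} (h : (z / 2) ^ 2 = -w) :
    besselY0 z = 2 / (Real.pi : ℂ) * log (z / 2) * seriesA w - 2 / (Real.pi : ℂ) * seriesB w := by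
  rw [besselY0, besselJ0_eq_seriesA h, seriesB]
  congr 2
  refine tsum_congr fun l => ?_
  rw [pow_mul, h, neg_pow w]
  have : ((-1 : ℂ) ^ l) * (-1) ^ l = 1 := by rw [← mul_pow]; simp
  linear_combination (1 / ((l.factorial : ℂ) ^ 2) * digamma ((l : ℂ) + 1) * w ^ l) * this

/-! ### The variable `w` and the branch of the logarithm -/

/-- The rescaled variable `w = λ |y|² / 4`. -/
def scaledSq (lam : ℂ) (y : Plane) : ℂ := lam / 4 * ((‖y‖ ^ 2 : ℝ) : ℂ)

theorem scaledSq_eq_real_mul (lam : ℂ) (y : Plane) :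
    scaledSq lam y = ((‖y‖ ^ 2 / 4 : ℝ) : ℂ) * lam := by
  rw [scaledSq]; push_cast; ring

theorem norm_scaledSq (lam : ℂ) (y : Plane) : ‖scaledSq lam y‖ = ‖lam‖ * ‖y‖ ^ 2 / 4 := by
  rw [scaledSq_eq_real_mul, norm_mul, norm_real, Real.norm_eq_abs, abs_of_nonneg (by positivity)]
  ring

theorem sector_subset_slitPlane {θ : ℝ} (hθ : 0 < θ) {lam : ℂ} (h : lam ∈ sector θ) :
    lam ∈ slitPlane := by
  rw [mem_slitPlane_iff_arg]
  refine ⟨fun h' => ?_, h.1⟩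
  have h2 := h.2
  rw [h', abs_of_pos Real.pi_pos] at h2
  linarith

theorem scaledSq_mem_slitPlane {lam : ℂ} (h : lam ∈ slitPlane) {y : Plane} (hy : y ≠ 0) :
    scaledSq lam y ∈ slitPlane := by
  have hy' := norm_pos_iff.2 hy
  rw [mem_slitPlane_iff_arg, scaledSq_eq_real_mul, arg_real_mul _ (by positivity)]
  exact ⟨(mem_slitPlane_iff_arg.1 h).1,
    mul_ne_zero (ofReal_ne_zero.2 (by positivity)) (slitPlane_ne_zero h)⟩

theorem log_scaledSq {lam : ℂ} (h : lam ≠ 0) {y : Plane} (hy : y ≠ 0) :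
    log (scaledSq lam y) = 2 * ((Real.log ‖y‖ : ℝ) : ℂ) + log (lam / 4) := by
  have hy' := norm_pos_iff.2 hy
  rw [scaledSq, mul_comm, log_ofReal_mul (by positivity) (div_ne_zero h (by norm_num)),
    Real.log_pow]
  push_cast
  ring

/-- Writes the Hankel argument as an explicit square root of `-w`, from which both its square and
its principal logarithm can be read off. -/
theorem waveNumber_mul_norm_div_two {lam : ℂ} (h : lam ≠ 0) {y : Plane} (hy : y ≠ 0) :
    waveNumber lam * (‖y‖ : ℂ) / 2 = exp ((log (scaledSq lam y) + Real.pi * I) / 2) := by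
  have hy' := norm_pos_iff.2 hy
  have hl := norm_pos_iff.2 h
  have harg : arg (scaledSq lam y) = arg lam := by
    rw [scaledSq_eq_real_mul, arg_real_mul _ (by positivity)]
  have hsq : Real.exp (Real.log ‖scaledSq lam y‖ / 2) = Real.sqrt ‖lam‖ * ‖y‖ / 2 := by
    rw [← Real.log_sqrt (norm_nonneg _), Real.exp_log, norm_scaledSq]
    · rw [show ‖lam‖ * ‖y‖ ^ 2 / 4 = ‖lam‖ * (‖y‖ / 2) ^ 2 by ring, Real.sqrt_mul hl.le,
        Real.sqrt_sq (by positivity)]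
      ring
    · rw [norm_scaledSq]; positivity
  have : (log (scaledSq lam y) + Real.pi * I) / 2
      = ((Real.log ‖scaledSq lam y‖ / 2 : ℝ) : ℂ)
        + I * ((Real.pi + arg lam : ℝ) : ℂ) / 2 := by
    rw [log, harg]; push_cast; ring
  rw [this, exp_add, ← ofReal_exp, hsq, waveNumber]
  push_cast
  ring

theorem helmholtzG_eq {lam : ℂ} (h : lam ≠ 0) {y : Plane} (hy : y ≠ 0) :
    helmholtzG lam y = -(1 / (4 * (Real.pi : ℂ))) *
      (log (scaledSq lam y) * seriesA (scaledSq lam y) - 2 * seriesB (scaledSq lam y)) := by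
  have hy' := norm_pos_iff.2 hy
  have hz := waveNumber_mul_norm_div_two h hy
  have hw : scaledSq lam y ≠ 0 := by
    rw [← norm_pos_iff, norm_scaledSq]
    have := norm_pos_iff.2 h
    positivity
  have hsq : (waveNumber lam * (‖y‖ : ℂ) / 2) ^ 2 = -scaledSq lam y := by
    rw [hz, ← exp_nat_mul]
    rw [show ((2 : ℕ) : ℂ) * ((log (scaledSq lam y) + Real.pi * I) / 2)
      = log (scaledSq lam y) + Real.pi * I by push_cast; ring, exp_add, exp_log hw, exp_pi_mul_I]
    ring
  have hlog : log (waveNumber lam * (‖y‖ : ℂ) / 2)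
      = (log (scaledSq lam y) + Real.pi * I) / 2 := by
    have him : ((log (scaledSq lam y) + Real.pi * I) / 2).im
        = (arg (scaledSq lam y) + Real.pi) / 2 := by
      simp [log_im]
    have h1 := neg_pi_lt_arg (scaledSq lam y)
    have h2 := arg_le_pi (scaledSq lam y)
    -- As `arg w` lies in `(-π, π]`, the imaginary part lies in `(0, π]`, so the principal logarithm
    -- inverts `exp` with no multiple of `2πi`.
    rw [hz, log_exp]
    · rw [him]; linarith [Real.pi_pos]
    · rw [him]; linarith [Real.pi_pos]
  have hpi : (Real.pi : ℂ) ≠ 0 := ofReal_ne_zero.2 Real.pi_ne_zero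
  rw [helmholtzG, hankelH0, besselJ0_eq_seriesA hsq, besselY0_eq_series hsq, hlog]
  field_simp
  ring_nf
  simp only [I_sq, show I ^ 3 = -I by rw [pow_succ, I_sq]; ring]
  ring

/-! ### Radial profiles and their derivatives -/

/-- The profile `h` with `G(y; λ) - G(y; 0) = -(h(λ|y|²/4) + log (λ/4)) / 4π`. -/
def profile (w : ℂ) : ℂ := log w * (w + w ^ 2 * seriesE w) - 2 * seriesB w

theorem helmholtzG_sub_laplaceG {lam : ℂ} (h : lam ≠ 0) {y : Plane} (hy : y ≠ 0) :
    helmholtzG lam y - laplaceG y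
      = -(1 / (4 * (Real.pi : ℂ))) * (profile (scaledSq lam y) + log (lam / 4)) := by
  have hlog := log_scaledSq h hy
  have hpi : (Real.pi : ℂ) ≠ 0 := ofReal_ne_zero.2 Real.pi_ne_zero
  rw [helmholtzG_eq h hy, laplaceG, seriesA_eq, profile,
    show log (lam / 4) = log (scaledSq lam y) - 2 * ((Real.log ‖y‖ : ℝ) : ℂ) by rw [hlog]; ring]
  push_cast
  field_simp
  ring

theorem _root_.Differentiable.deriv_complex {f : ℂ → ℂ} (hf : Differentiable ℂ f) :
    Differentiable ℂ (deriv f) := fun w =>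
  ((hf.analyticAt w).deriv).differentiableAt

theorem hasDerivAt_log_mul_add {p q : ℂ → ℂ} (hp : Differentiable ℂ p) (hq : Differentiable ℂ q)
    {w : ℂ} (hw : w ∈ slitPlane) :
    HasDerivAt (fun v => log v * p v + q v) (log w * deriv p w + (p w / w + deriv q w)) w := by
  refine (((hasDerivAt_log hw).fun_mul (hp w).hasDerivAt).fun_add (hq w).hasDerivAt).congr_deriv ?_
  ring

/-- The coefficient of `log w` in the second derivative of the profile. -/
def coeffM (w : ℂ) : ℂ :=
  2 * seriesE w + 4 * w * deriv seriesE w + w ^ 2 * deriv (deriv seriesE) w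

/-- The entire part of the second derivative of the profile. -/
def coeffN (w : ℂ) : ℂ :=
  3 * seriesE w + 2 * w * deriv seriesE w - 2 * deriv (deriv seriesB) w

/-- `w K(w)` is the coefficient of `log w` in the radial coefficient of `δ_{αβ}`. -/
def coeffK (w : ℂ) : ℂ := 1 + w * seriesE w - seriesE w - w * deriv seriesE w / 2

/-- The entire part of the radial coefficient of `δ_{αβ}`. -/
def coeffL (w : ℂ) : ℂ := -2 * seriesB w - (1 + w * seriesE w) / 2 + deriv seriesB w

theorem differentiable_coeffM : Differentiable ℂ coeffM := by
  have h0 := differentiable_seriesE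
  have h1 := h0.deriv_complex
  have h2 := h1.deriv_complex
  unfold coeffM
  fun_prop

theorem differentiable_coeffN : Differentiable ℂ coeffN := by
  have h0 := differentiable_seriesE
  have h1 := h0.deriv_complex
  have h2 := differentiable_seriesB.deriv_complex.deriv_complex
  unfold coeffN
  fun_prop

theorem differentiable_coeffK : Differentiable ℂ coeffK := by
  have h0 := differentiable_seriesE
  have h1 := h0.deriv_complex
  unfold coeffK
  fun_prop

theorem differentiable_coeffL : Differentiable ℂ coeffL := by
  have h0 := differentiable_seriesE
  have h1 := differentiable_seriesB
  have h2 := h1.deriv_complex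
  unfold coeffL
  fun_prop

/-- The derivative of `profile`. -/
def profileDeriv (w : ℂ) : ℂ :=
  log w * (1 + 2 * w * seriesE w + w ^ 2 * deriv seriesE w)
    + (1 + w * seriesE w - 2 * deriv seriesB w)

theorem hasDerivAt_profile {w : ℂ} (hw : w ∈ slitPlane) :
    HasDerivAt profile (profileDeriv w) w := by
  have hw0 := slitPlane_ne_zero hw
  have hE := (differentiable_seriesE w).hasDerivAt
  have hB := (differentiable_seriesB w).hasDerivAt
  have hid := hasDerivAt_id' w
  refine (((hasDerivAt_log hw).fun_mul (hid.fun_add ((hid.fun_pow 2).fun_mul hE))).fun_sub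
    (hB.const_mul 2)).congr_deriv ?_
  simp only [profileDeriv]
  push_cast
  field_simp
  ring

/-- The `1/w` is kept apart because it is exactly the part that the stationary matrix cancels; the
rest is `radialR`. -/
theorem hasDerivAt_profileDeriv {w : ℂ} (hw : w ∈ slitPlane) :
    HasDerivAt profileDeriv (1 / w + (log w * coeffM w + coeffN w)) w := by
  have hw0 := slitPlane_ne_zero hw
  have hE := (differentiable_seriesE w).hasDerivAt
  have hE' := (differentiable_seriesE.deriv_complex w).hasDerivAt
  have hB := (differentiable_seriesB.deriv_complex w).hasDerivAt
  have hid := hasDerivAt_id' w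
  refine (((hasDerivAt_log hw).fun_mul ((((hid.const_mul 2).fun_mul hE).const_add 1).fun_add
    ((hid.fun_pow 2).fun_mul hE'))).fun_add
    (((hid.fun_mul hE).const_add 1).fun_sub (hB.const_mul 2))).congr_deriv ?_
  simp only [coeffM, coeffN]
  push_cast
  field_simp
  ring

/-- The radial coefficient of `δ_{αβ}` in `Γ(·; λ) - Γ(·; 0)`, up to constants. -/
def radialP (w : ℂ) : ℂ := log w * (w * coeffK w) + coeffL w

/-- The derivative of `radialP`. -/
def radialPDeriv (w : ℂ) : ℂ :=
  log w * deriv (fun v => v * coeffK v) w + (coeffK w + deriv coeffL w)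

/-- The radial coefficient of `x_α x_β` in `Γ(·; λ) - Γ(·; 0)`, up to constants. -/
def radialR (w : ℂ) : ℂ := log w * coeffM w + coeffN w

/-- The derivative of `radialR`. -/
def radialRDeriv (w : ℂ) : ℂ := log w * deriv coeffM w + (coeffM w / w + deriv coeffN w)

theorem hasDerivAt_radialP {w : ℂ} (hw : w ∈ slitPlane) :
    HasDerivAt radialP (radialPDeriv w) w := by
  refine (hasDerivAt_log_mul_add (p := fun v => v * coeffK v)
    (differentiable_id.fun_mul differentiable_coeffK) differentiable_coeffL hw).congr_deriv ?_
  rw [radialPDeriv, mul_div_cancel_left₀ _ (slitPlane_ne_zero hw)]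

theorem hasDerivAt_radialR {w : ℂ} (hw : w ∈ slitPlane) :
    HasDerivAt radialR (radialRDeriv w) w :=
  hasDerivAt_log_mul_add differentiable_coeffM differentiable_coeffN hw

/-! ### Logarithmic bounds on the unit disc -/

theorem exists_norm_le_of_differentiable {f : ℂ → ℂ} (hf : Differentiable ℂ f) :
    ∃ C : ℝ, 0 ≤ C ∧ ∀ w : ℂ, ‖w‖ ≤ 1 → ‖f w‖ ≤ C := by
  obtain ⟨C, hC⟩ := (isCompact_closedBall (0 : ℂ) 1).exists_bound_of_continuousOn
    hf.continuous.continuousOn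
  exact ⟨C, (norm_nonneg _).trans (hC 0 (by simp)), fun w hw => hC w (by simpa using hw)⟩

theorem exists_norm_log_mul_add_le {p q : ℂ → ℂ} (hp : Differentiable ℂ p)
    (hq : Differentiable ℂ q) :
    ∃ C : ℝ, 0 ≤ C ∧ ∀ w : ℂ, ‖w‖ ≤ 1 → ‖log w * p w + q w‖ ≤ C * (‖log w‖ + 1) := by
  obtain ⟨C, hC0, hC⟩ := exists_norm_le_of_differentiable hp
  obtain ⟨D, hD0, hD⟩ := exists_norm_le_of_differentiable hq
  refine ⟨C + D, by positivity, fun w hw => ?_⟩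
  calc ‖log w * p w + q w‖ ≤ ‖log w‖ * ‖p w‖ + ‖q w‖ := by
        rw [← norm_mul]; exact norm_add_le _ _
    _ ≤ ‖log w‖ * C + D := by gcongr; exacts [hC w hw, hD w hw]
    _ ≤ (C + D) * (‖log w‖ + 1) := by nlinarith [norm_nonneg (log w)]

theorem exists_radial_bounds :
    ∃ C : ℝ, 0 ≤ C ∧ ∀ w : ℂ, w ≠ 0 → ‖w‖ ≤ 1 →
      ‖radialPDeriv w‖ ≤ C * (‖log w‖ + 1) ∧ ‖radialR w‖ ≤ C * (‖log w‖ + 1) ∧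
        ‖w‖ * ‖radialRDeriv w‖ ≤ C * (‖log w‖ + 1) := by
  have hK := differentiable_coeffK
  have hL := differentiable_coeffL.deriv_complex
  have hM := differentiable_coeffM
  have hM' := hM.deriv_complex
  have hN := differentiable_coeffN
  have hN' := hN.deriv_complex
  have hwK : Differentiable ℂ (fun v => v * coeffK v) := by fun_prop
  obtain ⟨C₁, h₁, H₁⟩ := exists_norm_log_mul_add_le hwK.deriv_complex (hK.fun_add hL)
  obtain ⟨C₂, h₂, H₂⟩ := exists_norm_log_mul_add_le hM hN
  obtain ⟨C₃, h₃, H₃⟩ := exists_norm_log_mul_add_le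
    (p := fun w => w * deriv coeffM w) (q := fun w => coeffM w + w * deriv coeffN w)
    (by fun_prop) (by fun_prop)
  refine ⟨C₁ + C₂ + C₃, by positivity, fun w hw0 hw => ⟨?_, ?_, ?_⟩⟩
  · exact (H₁ w hw).trans (by gcongr; linarith)
  · exact (H₂ w hw).trans (by gcongr; linarith)
  -- The pole `M(w)/w` of `R'` is cleared by the factor `w`, which the product `λ x_α x_β` will
  -- supply.
  · have : w * radialRDeriv w
        = log w * (w * deriv coeffM w) + (coeffM w + w * deriv coeffN w) := by
      rw [radialRDeriv]; field_simp
    rw [← norm_mul, this]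
    exact (H₃ w hw).trans (by gcongr; linarith)

/-! ### Partial derivatives and the cancellation -/

theorem hasLineDerivAt_scaledSq (lam : ℂ) (x : Plane) (γ : Fin 2) :
    HasLineDerivAt ℝ (scaledSq lam) (lam / 2 * (x γ : ℂ)) x (EuclideanSpace.single γ 1) := by
  have h := (hasStrictFDerivAt_norm_sq x).hasFDerivAt.hasLineDerivAt
    (EuclideanSpace.single γ (1 : ℝ))
  have h' := (HasDerivAt.ofReal_comp h).const_mul (lam / 4)
  refine HasDerivAt.congr_deriv h' ?_
  simp [EuclideanSpace.inner_single_right]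
  ring

theorem hasLineDerivAt_coord (x : Plane) (α γ : Fin 2) :
    HasLineDerivAt ℝ (fun y : Plane => (y α : ℂ)) (if α = γ then 1 else 0) x
      (EuclideanSpace.single γ 1) := by
  have h := (EuclideanSpace.proj α : Plane →L[ℝ] ℝ).hasFDerivAt (x := x)
    |>.hasLineDerivAt (EuclideanSpace.single γ (1 : ℝ))
  refine HasDerivAt.congr_deriv (HasDerivAt.ofReal_comp h) ?_
  by_cases hαγ : α = γ <;> simp [hαγ]

theorem hasLineDerivAt_comp_scaledSq {f : ℂ → ℂ} {f' lam : ℂ} {x : Plane} {v : Plane} {u' : ℂ}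
    (hf : HasDerivAt f f' (scaledSq lam x)) (hu : HasLineDerivAt ℝ (scaledSq lam) u' x v) :
    HasLineDerivAt ℝ (fun y => f (scaledSq lam y)) (f' * u') x v := by
  have h : HasDerivAt f f' (scaledSq lam (x + (0 : ℝ) • v)) := by simpa using hf
  exact HasDerivAt.comp (0 : ℝ) h hu

theorem partialDeriv_helmholtzG_sub_laplaceG {lam : ℂ} (h : lam ∈ slitPlane) {y : Plane}
    (hy : y ≠ 0) (β : Fin 2) :
    partialDeriv β (fun z => helmholtzG lam z - laplaceG z) y
      = -(1 / (4 * (Real.pi : ℂ))) * (profileDeriv (scaledSq lam y) * (lam / 2 * (y β : ℂ))) := by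
  have hev : (fun z => helmholtzG lam z - laplaceG z) =ᶠ[𝓝 y]
      fun z => -(1 / (4 * (Real.pi : ℂ))) * (profile (scaledSq lam z) + log (lam / 4)) := by
    filter_upwards [isOpen_ne.mem_nhds hy] with z hz
    exact helmholtzG_sub_laplaceG (slitPlane_ne_zero h) hz
  rw [partialDeriv, hev.lineDeriv_eq]
  have h1 := hasLineDerivAt_comp_scaledSq (hasDerivAt_profile (scaledSq_mem_slitPlane h hy))
    (hasLineDerivAt_scaledSq lam y β)
  exact HasLineDerivAt.lineDeriv ((HasDerivAt.add_const _ h1).const_mul _)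

theorem partialDeriv_partialDeriv_helmholtzG_sub_laplaceG {lam : ℂ} (h : lam ∈ slitPlane)
    {y : Plane} (hy : y ≠ 0) (α β : Fin 2) :
    partialDeriv α (partialDeriv β (fun z => helmholtzG lam z - laplaceG z)) y
      = -(1 / (4 * (Real.pi : ℂ))) *
        ((1 / scaledSq lam y + radialR (scaledSq lam y)) * (lam / 2 * (y α : ℂ))
            * (lam / 2 * (y β : ℂ))
          + profileDeriv (scaledSq lam y) * (lam / 2 * (if β = α then 1 else 0))) := by
  have hev : partialDeriv β (fun z => helmholtzG lam z - laplaceG z) =ᶠ[𝓝 y] fun z =>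
      -(1 / (4 * (Real.pi : ℂ))) * (profileDeriv (scaledSq lam z) * (lam / 2 * (z β : ℂ))) := by
    filter_upwards [isOpen_ne.mem_nhds hy] with z hz
    exact partialDeriv_helmholtzG_sub_laplaceG h hz β
  rw [partialDeriv, hev.lineDeriv_eq]
  have h1 := hasLineDerivAt_comp_scaledSq (hasDerivAt_profileDeriv (scaledSq_mem_slitPlane h hy))
    (hasLineDerivAt_scaledSq lam y α)
  have h2 := HasDerivAt.const_mul (lam / 2) (hasLineDerivAt_coord y β α)
  have h3 := (HasDerivAt.fun_mul h1 h2).const_mul (-(1 / (4 * (Real.pi : ℂ))))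
  refine (HasDerivAt.deriv h3).trans ?_
  simp [radialR]

theorem resolventGamma_sub_stationaryGamma {lam : ℂ} (h : lam ∈ slitPlane) {y : Plane}
    (hy : y ≠ 0) (α β : Fin 2) :
    resolventGamma lam y α β - stationaryGamma y α β
      = -(1 / (4 * (Real.pi : ℂ))) *
        ((if α = β then 1 else 0) * (radialP (scaledSq lam y) + log (lam / 4) / 2)
          - lam / 4 * ((y α : ℂ) * (y β : ℂ) * radialR (scaledSq lam y))) := by
  have hlam := slitPlane_ne_zero h
  have hpi : (Real.pi : ℂ) ≠ 0 := ofReal_ne_zero.2 Real.pi_ne_zero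
  have hn : (‖y‖ : ℂ) ≠ 0 := ofReal_ne_zero.2 (norm_ne_zero_iff.2 hy)
  have hlog := log_scaledSq hlam hy
  simp only [resolventGamma, stationaryGamma, Matrix.of_apply]
  rw [partialDeriv_partialDeriv_helmholtzG_sub_laplaceG h hy, helmholtzG_eq hlam hy, seriesA_eq,
    show log (lam / 4) = log (scaledSq lam y) - 2 * ((Real.log ‖y‖ : ℝ) : ℂ) by rw [hlog]; ring]
  have hinv : 1 / scaledSq lam y = 4 / (lam * (‖y‖ : ℂ) ^ 2) := by
    rw [scaledSq]; push_cast; field_simp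
  rw [hinv]
  -- With `1/w` and `log (λ/4)` rewritten, the identity is rational in `log w`, the series values
  -- and the coordinates, so the link between `w` and `y` can be forgotten.
  generalize scaledSq lam y = w
  simp only [profileDeriv, radialP, coeffK, coeffL, eq_comm (a := β)]
  generalize radialR w = R
  split_ifs <;> (push_cast; field_simp; ring)

theorem contDiff_scaledSq (lam : ℂ) {n : WithTop ℕ∞} : ContDiff ℝ n (scaledSq lam) :=
  contDiff_const.mul (ofRealCLM.contDiff.comp (contDiff_norm_sq ℝ))

/-- The profile is holomorphic on the slit plane, hence analytic there, and `w` is a smooth function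
of `y`; this gives every order of smoothness. -/
theorem contDiffAt_helmholtzG_sub_laplaceG {lam : ℂ} (h : lam ∈ slitPlane) {x : Plane}
    (hx : x ≠ 0) {n : WithTop ℕ∞} :
    ContDiffAt ℝ n (fun y => helmholtzG lam y - laplaceG y) x := by
  have hev : (fun z => helmholtzG lam z - laplaceG z) =ᶠ[𝓝 x]
      fun z => -(1 / (4 * (Real.pi : ℂ))) * (profile (scaledSq lam z) + log (lam / 4)) := by
    filter_upwards [isOpen_ne.mem_nhds hx] with z hz
    exact helmholtzG_sub_laplaceG (slitPlane_ne_zero h) hz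
  have hp : ContDiffAt ℂ n profile (scaledSq lam x) := by
    have hd : DifferentiableOn ℂ profile slitPlane := fun w hw =>
      (hasDerivAt_profile hw).differentiableAt.differentiableWithinAt
    exact (hd.analyticAt (isOpen_slitPlane.mem_nhds (scaledSq_mem_slitPlane h hx))).contDiffAt
  have hc : ContDiffAt ℝ n (fun z => profile (scaledSq lam z)) x :=
    (hp.restrict_scalars ℝ).comp x (contDiff_scaledSq lam).contDiffAt
  exact (contDiffAt_const.mul (hc.add contDiffAt_const)).congr_of_eventuallyEq hev

/-! ### Gradient of the difference and its estimate -/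

theorem resolventGamma_sub_stationaryGamma_eventuallyEq {lam : ℂ} (h : lam ∈ slitPlane)
    {x : Plane} (hx : x ≠ 0) (α β : Fin 2) :
    (fun y => resolventGamma lam y α β - stationaryGamma y α β) =ᶠ[𝓝 x] fun y =>
      -(1 / (4 * (Real.pi : ℂ))) *
        ((if α = β then 1 else 0) * (radialP (scaledSq lam y) + log (lam / 4) / 2)
          - lam / 4 * ((y α : ℂ) * (y β : ℂ) * radialR (scaledSq lam y))) := by
  filter_upwards [isOpen_ne.mem_nhds hx] with y hy
  exact resolventGamma_sub_stationaryGamma h hy α β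

theorem differentiableAt_resolventGamma_sub_stationaryGamma {lam : ℂ} (h : lam ∈ slitPlane)
    {x : Plane} (hx : x ≠ 0) (α β : Fin 2) :
    DifferentiableAt ℝ (fun y => resolventGamma lam y α β - stationaryGamma y α β) x := by
  refine DifferentiableAt.congr_of_eventuallyEq ?_
    (resolventGamma_sub_stationaryGamma_eventuallyEq h hx α β)
  have hw := scaledSq_mem_slitPlane h hx
  have hu : DifferentiableAt ℝ (scaledSq lam) x :=
    (contDiff_scaledSq lam (n := 1)).differentiable (by norm_num) x
  have hP : DifferentiableAt ℝ (fun y => radialP (scaledSq lam y)) x :=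
    ((hasDerivAt_radialP hw).differentiableAt.restrictScalars ℝ).comp x hu
  have hR : DifferentiableAt ℝ (fun y => radialR (scaledSq lam y)) x :=
    ((hasDerivAt_radialR hw).differentiableAt.restrictScalars ℝ).comp x hu
  have hc : ∀ i : Fin 2, DifferentiableAt ℝ (fun y : Plane => (y i : ℂ)) x := fun i =>
    (ofRealCLM.comp (EuclideanSpace.proj i : Plane →L[ℝ] ℝ)).differentiableAt
  have hα := hc α
  have hβ := hc β
  fun_prop

theorem partialDeriv_resolventGamma_sub_stationaryGamma {lam : ℂ} (h : lam ∈ slitPlane)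
    {x : Plane} (hx : x ≠ 0) (α β γ : Fin 2) :
    partialDeriv γ (fun y => resolventGamma lam y α β - stationaryGamma y α β) x
      = -(1 / (4 * (Real.pi : ℂ))) *
        ((if α = β then 1 else 0) * (radialPDeriv (scaledSq lam x) * (lam / 2 * (x γ : ℂ)))
          - lam / 4 * (((if α = γ then 1 else 0) * (x β : ℂ) + (x α : ℂ) * (if β = γ then 1 else 0))
              * radialR (scaledSq lam x)
            + (x α : ℂ) * (x β : ℂ) * (radialRDeriv (scaledSq lam x) * (lam / 2 * (x γ : ℂ))))) := by
  have hw := scaledSq_mem_slitPlane h hx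
  have hu := hasLineDerivAt_scaledSq lam x γ
  have hP := hasLineDerivAt_comp_scaledSq (hasDerivAt_radialP hw) hu
  have hR := hasLineDerivAt_comp_scaledSq (hasDerivAt_radialR hw) hu
  have hαβ := HasDerivAt.fun_mul (hasLineDerivAt_coord x α γ) (hasLineDerivAt_coord x β γ)
  have hD := (((HasDerivAt.add_const (log (lam / 4) / 2) hP).const_mul
    (if α = β then (1 : ℂ) else 0)).fun_sub
      ((HasDerivAt.fun_mul hαβ hR).const_mul (lam / 4))).const_mul (-(1 / (4 * (Real.pi : ℂ))))
  rw [partialDeriv, (resolventGamma_sub_stationaryGamma_eventuallyEq h hx α β).lineDeriv_eq]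
  refine (HasDerivAt.deriv hD).trans ?_
  simp

theorem norm_partialDeriv_resolventGamma_sub_stationaryGamma_le {lam : ℂ} (h : lam ∈ slitPlane)
    {x : Plane} (hx : x ≠ 0) {T : ℝ}
    (hP : ‖radialPDeriv (scaledSq lam x)‖ ≤ T) (hR : ‖radialR (scaledSq lam x)‖ ≤ T)
    (hR' : ‖scaledSq lam x‖ * ‖radialRDeriv (scaledSq lam x)‖ ≤ T) (α β γ : Fin 2) :
    ‖partialDeriv γ (fun y => resolventGamma lam y α β - stationaryGamma y α β) x‖
      ≤ T * ‖lam‖ * ‖x‖ := by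
  have hT : 0 ≤ T := (norm_nonneg _).trans hP
  have hcoord : ∀ i : Fin 2, ‖(x i : ℂ)‖ ≤ ‖x‖ := fun i => by
    rw [norm_real]; exact PiLp.norm_apply_le x i
  have hδ : ∀ i j : Fin 2, ‖(if i = j then (1 : ℂ) else 0)‖ ≤ 1 := fun i j => by
    split_ifs <;> simp
  rw [partialDeriv_resolventGamma_sub_stationaryGamma h hx]
  rw [norm_scaledSq] at hR'
  generalize radialPDeriv (scaledSq lam x) = p at *
  generalize radialR (scaledSq lam x) = r at *
  generalize radialRDeriv (scaledSq lam x) = r' at *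
  have hpi : ‖-(1 / (4 * (Real.pi : ℂ)))‖ ≤ 1 / 2 := by
    rw [norm_neg, norm_div, norm_mul, norm_real, Real.norm_of_nonneg Real.pi_pos.le]
    simp only [norm_one, Complex.norm_ofNat]
    exact one_div_le_one_div_of_le (by norm_num) (by linarith [Real.pi_gt_three])
  have h1 : ‖(if α = β then (1 : ℂ) else 0) * (p * (lam / 2 * (x γ : ℂ)))‖
      ≤ T * ‖lam‖ * ‖x‖ / 2 := by
    simp only [norm_mul, norm_div, Complex.norm_ofNat]
    calc _ ≤ 1 * (T * (‖lam‖ / 2 * ‖x‖)) := by gcongr; exacts [hδ _ _, hcoord _]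
      _ = _ := by ring
  have h2 : ‖((if α = γ then (1 : ℂ) else 0) * (x β : ℂ)
      + (x α : ℂ) * (if β = γ then 1 else 0)) * r‖ ≤ 2 * T * ‖x‖ := by
    rw [norm_mul]
    calc _ ≤ (1 * ‖x‖ + ‖x‖ * 1) * T := by
          gcongr
          refine (norm_add_le _ _).trans ?_
          rw [norm_mul, norm_mul]
          gcongr
          exacts [hδ _ _, hcoord _, hcoord _, hδ _ _]
      _ = _ := by ring
  -- Two coordinates together with `λ` amount to `4|w|`, which pairs with `r'` so that only
  -- `|w||R'|` has to be bounded.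
  have h3 : ‖(x α : ℂ) * (x β : ℂ) * (r' * (lam / 2 * (x γ : ℂ)))‖ ≤ 2 * T * ‖x‖ := by
    simp only [norm_mul, norm_div, Complex.norm_ofNat]
    calc _ ≤ ‖x‖ * ‖x‖ * (‖r'‖ * (‖lam‖ / 2 * ‖x‖)) := by
          gcongr <;> exact hcoord _
      _ = 2 * (‖lam‖ * ‖x‖ ^ 2 / 4 * ‖r'‖) * ‖x‖ := by ring
      _ ≤ 2 * T * ‖x‖ := by gcongr
  rw [norm_mul]
  calc _ ≤ 1 / 2 * (T * ‖lam‖ * ‖x‖ / 2 + ‖lam‖ / 4 * (2 * T * ‖x‖ + 2 * T * ‖x‖)) := by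
        gcongr
        refine (norm_sub_le _ _).trans (add_le_add h1 ?_)
        rw [norm_mul, norm_div, Complex.norm_ofNat]
        gcongr
        exact (norm_add_le _ _).trans (add_le_add h2 h3)
    _ = 3 / 4 * (T * ‖lam‖ * ‖x‖) := by ring
    _ ≤ T * ‖lam‖ * ‖x‖ := by
        have : 0 ≤ T * ‖lam‖ * ‖x‖ := by positivity
        linarith

theorem gradNorm_le_of_forall {F : Plane → Matrix (Fin 2) (Fin 2) ℂ} {x : Plane} {b : ℝ}
    (hF : ∀ α β γ, ‖partialDeriv γ (fun y => F y α β) x‖ ≤ b) :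
    gradNorm F x ≤ 3 * b := by
  have hb : 0 ≤ b := (norm_nonneg _).trans (hF 0 0 0)
  refine Real.sqrt_le_iff.2 ⟨by positivity, ?_⟩
  calc _ ≤ ∑ _γ : Fin 2, ∑ _α : Fin 2, ∑ _β : Fin 2, b ^ 2 := by
        gcongr with γ _ α _ β _
        exact hF α β γ
    -- There are `2³` partial derivatives, and `√8 ≤ 3`.
    _ = 8 * b ^ 2 := by simp; ring
    _ ≤ (3 * b) ^ 2 := by nlinarith [sq_nonneg b]

/-- The argument contributes at most `π` and the factor `1/4` at most `2 log 2`. Since `|log s| ≥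
log 2` for `s = |λ||x|² ≤ 1/2`, nine copies of `|log s|` cover these constants together with the
`1`. -/
theorem norm_log_scaledSq_add_one_le {lam : ℂ} (h : lam ≠ 0) {x : Plane} (hx : x ≠ 0)
    (hle : ‖lam‖ * ‖x‖ ^ 2 ≤ 1 / 2) :
    ‖log (scaledSq lam x)‖ + 1 ≤ 10 * |Real.log (‖lam‖ * ‖x‖ ^ 2)| := by
  have hl := norm_pos_iff.2 h
  have hx' := norm_pos_iff.2 hx
  set s := ‖lam‖ * ‖x‖ ^ 2 with hs
  have hs0 : 0 < s := by positivity
  have hlog2 := Real.log_two_gt_d9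
  have hlog2' := Real.log_two_lt_d9
  have hlogs : Real.log s ≤ -Real.log 2 := by
    rw [← Real.log_inv]
    exact Real.log_le_log hs0 (by linarith)
  have hre : |(log (scaledSq lam x)).re| ≤ |Real.log s| + 2 * Real.log 2 := by
    rw [log_re, norm_scaledSq, Real.log_div hs0.ne' (by norm_num),
      show (4 : ℝ) = 2 ^ 2 by norm_num, Real.log_pow]
    refine (abs_sub _ _).trans ?_
    rw [abs_of_nonneg (a := ((2 : ℕ) : ℝ) * Real.log 2) (by positivity)]
    norm_num
  have him : |(log (scaledSq lam x)).im| ≤ Real.pi := by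
    rw [log_im]; exact abs_arg_le_pi _
  have hn := norm_le_abs_re_add_abs_im (log (scaledSq lam x))
  have hpi := Real.pi_lt_d2
  rw [abs_of_nonpos (by linarith : Real.log s ≤ 0)] at *
  linarith

end StokesResolvent

end

theorem mainTheorem11 (θ : ℝ) (hθ : θ ∈ Set.Ioo 0 (Real.pi / 2)) :
    ∃ C : ℝ, 0 < C ∧
      ∀ lam ∈ StokesResolvent.sector θ, ∀ x : StokesResolvent.Plane, x ≠ 0 →
        ‖lam‖ * ‖x‖ ^ 2 ≤ 1 / 2 →
          -- the derivatives involved exist in the classical sense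
          ContDiffAt ℝ 3
            (fun y => StokesResolvent.helmholtzG lam y - StokesResolvent.laplaceG y) x ∧
          (∀ α β : Fin 2, DifferentiableAt ℝ
            (fun y => StokesResolvent.resolventGamma lam y α β
              - StokesResolvent.stationaryGamma y α β) x) ∧
          StokesResolvent.gradNorm
              (fun y => StokesResolvent.resolventGamma lam y
                - StokesResolvent.stationaryGamma y) x
            ≤ C * ‖lam‖ * ‖x‖ * |Real.log (‖lam‖ * ‖x‖ ^ 2)| := by
  open StokesResolvent in
  obtain ⟨C, hC0, hC⟩ := exists_radial_bounds
  -- `30 = 3 · 10`, from the eight entries and from the logarithm comparison; the `+ 1` only secures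
  -- positivity, as `C` may be `0`.
  refine ⟨30 * C + 1, by positivity, fun lam hlam x hx hle => ?_⟩
  have h := sector_subset_slitPlane hθ.1 hlam
  refine ⟨contDiffAt_helmholtzG_sub_laplaceG h hx,
    differentiableAt_resolventGamma_sub_stationaryGamma h hx, ?_⟩
  have hw : ‖scaledSq lam x‖ ≤ 1 := by rw [norm_scaledSq]; linarith
  obtain ⟨h1, h2, h3⟩ :=
    hC _ (Complex.slitPlane_ne_zero (scaledSq_mem_slitPlane h hx)) hw
  have hlog := norm_log_scaledSq_add_one_le hlam.1 hx hle
  refine (gradNorm_le_of_forall fun α β γ =>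
    norm_partialDeriv_resolventGamma_sub_stationaryGamma_le h hx h1 h2 h3 α β γ).trans ?_
  calc 3 * (C * (‖Complex.log (scaledSq lam x)‖ + 1) * ‖lam‖ * ‖x‖)
      ≤ 3 * (C * (10 * |Real.log (‖lam‖ * ‖x‖ ^ 2)|) * ‖lam‖ * ‖x‖) := by gcongr
    _ = 30 * C * ‖lam‖ * ‖x‖ * |Real.log (‖lam‖ * ‖x‖ ^ 2)| := by ring
    _ ≤ _ := by gcongr; linarith
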